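/- Let $(y_i,a_i)_{i=1}^n$ be a data set with targets $y_i\in\mathbb R$ and protected-attribute combinations $a_i$ in a finite set $A$, and let $\phi:\mathbb R\to[0,1]$ be a relevance function. For $t\in[0,1]$ and $\alpha\in A$ put $D_\alpha^t=\{i: a_i=\alpha,\ \phi(y_i)\ge t\}$, and for predictions $\hat y\in\mathbb R^n$ let $$E_\alpha^t(\hat y)=\frac{1}{|D_\alpha^t|}\sum_{i\in D_\alpha^t}(\hat y_i-y_i)^2\quad(D_\alpha^t\neq\emptyset),\qquad E_\alpha^t(\hat y)=0\quad(D_\alpha^t=\emptyset).$$ Let $\alpha_{\min}=\alpha_{\min}(\hat y,t)\in A$ minimize $E_\alpha^t(\hat y)$ among the $\alpha$ with $D_\alpha^t\ne\emptyset$ (arbitrary if there is none), where ties are broken arbitrarily but measurably in $t$. Define $$\mathrm{IDLoss}(\hat y)=\int_0^1\sum_{\alpha\in A\setminus\{\alpha_{\min}(\hat y,t)\}}E_\alpha^t(\hat y)\,dt,$$ $$C_j(\hat y)=\int_0^1\sum_{\alpha\in A\setminus\{\alpha_{\min}(\hat y,t)\}}\frac{2\cdot\mathbf 1(j\in D_\alpha^t)}{|D_\alpha^t|}\,dt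 ,\qquad G_j(\hat y)=C_j(\hat y)\,(\hat y_j-y_j),$$ where terms with $D_\alpha^t=\emptyset$ are $0$. Then $G(\hat y)=\nabla\,\mathrm{IDLoss}(\hat y)$ at every $\hat y$ at which $\mathrm{IDLoss}$ is differentiable. Moreover, let $\hat y^{(0)}\in\mathbb R^n$ be arbitrary and consider gradient descent $$\hat y^{(k+1)}=\hat y^{(k)}-\eta_k\,G(\hat y^{(k)})$$ with step sizes $\eta_k>0$ such that $\sum_k\eta_k=\infty$ and $\eta_k\,C_j(\hat y^{(k)})\le 1$ for all $k$ and $j$ (in particular this last condition holds if $\eta_k\le 1/L$ for some $L>0$ with $L\ge(\sum_jC_j(\hat y^{(k)})^2)^{1/2}$ for all $k$). Then the sequence $(\hat y^{(k)})$ converges to a stationary point of $\mathrm{IDLoss}$, that is, to a point at which $\mathrm{IDLoss}$ is differentiable with gradient $0$. -/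

import Mathlib

open Filter Topology

/-- A labelled data set of `n` samples: true target values `y`, the combination `group i` of protected
attribute values of sample `i` (an element of the finite set `A` of all combinations), and a
relevance function `φ` on target values with values in `[0, 1]`. -/
structure FairData (A : Type*) (n : ℕ) where
  y : Fin n → ℝ
  group : Fin n → A
  φ : ℝ → ℝ
  φ_mem : ∀ v, φ v ∈ Set.Icc (0 : ℝ) 1

namespace FairData

variable {A : Type*} [Fintype A] [DecidableEq A] {n : ℕ}

open Classical in
/-- `D_α^t`: the samples with attribute combination `α` and relevance at least `t`. -/
noncomputable def cell (S : FairData A n) (t : ℝ) (α : A) : Finset (Fin n) :=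
  Finset.univ.filter fun i => S.group i = α ∧ t ≤ S.φ (S.y i)

/-- The normalized error `(∑_{i ∈ D_α^t} (ŷ_i - y_i)²) / |D_α^t|`
(only meaningful when `D_α^t` is nonempty; it is `0` otherwise). -/
noncomputable def cellError (S : FairData A n) (p : EuclideanSpace ℝ (Fin n)) (t : ℝ) (α : A) : ℝ :=
  (∑ i ∈ S.cell t α, (p i - S.y i) ^ 2) / ((S.cell t α).card : ℝ)

/-- `αmin p t` is `α_min`, an attribute combination of minimal normalized error at cutoff `t` for the
predictions `p`. Only combinations represented at cutoff `t` compete; ties are broken arbitrarily,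
but measurably in `t`. -/
structure IsArgmin (S : FairData A n) (αmin : EuclideanSpace ℝ (Fin n) → ℝ → A) : Prop where
  nonempty : ∀ p, ∀ t ∈ Set.Icc (0 : ℝ) 1,
    (∃ α, (S.cell t α).Nonempty) → (S.cell t (αmin p t)).Nonempty
  le : ∀ p, ∀ t ∈ Set.Icc (0 : ℝ) 1, ∀ α, (S.cell t α).Nonempty →
    S.cellError p t (αmin p t) ≤ S.cellError p t α
  measurable : ∀ p α, MeasurableSet {t | αmin p t = α}

/-- `IDLoss(ŷ) = ∫₀¹ ∑_{α ≠ α_min} (∑_{i ∈ D_α^t} (ŷ_i - y_i)²) / |D_α^t| dt`. -/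
noncomputable def IDLoss (S : FairData A n) (αmin : EuclideanSpace ℝ (Fin n) → ℝ → A)
    (p : EuclideanSpace ℝ (Fin n)) : ℝ :=
  ∫ t in (0 : ℝ)..1, ∑ α ∈ Finset.univ.erase (αmin p t), S.cellError p t α

/-- `C_j = ∫₀¹ ∑_{α ≠ m(t)} 2 · 1(j ∈ D_α^t) / |D_α^t| dt`, the second partial derivative in
coordinate `j` when the excluded combination is `m t` at cutoff `t`. -/
noncomputable def curvature (S : FairData A n) (m : ℝ → A) (j : Fin n) : ℝ :=
  ∫ t in (0 : ℝ)..1, ∑ α ∈ Finset.univ.erase (m t),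
    (if j ∈ S.cell t α then 2 / ((S.cell t α).card : ℝ) else 0)

/-- The gradient formula of IDLoss: its `j`-th coordinate is
`∫₀¹ ∑_{α ≠ α_min} 2 (ŷ_j - y_j) · 1(j ∈ D_α^t) / |D_α^t| dt`. -/
noncomputable def lossGrad (S : FairData A n) (αmin : EuclideanSpace ℝ (Fin n) → ℝ → A)
    (p : EuclideanSpace ℝ (Fin n)) : EuclideanSpace ℝ (Fin n) :=
  WithLp.toLp 2 fun j => ∫ t in (0 : ℝ)..1, ∑ α ∈ Finset.univ.erase (αmin p t),
    (if j ∈ S.cell t α then 2 * (p j - S.y j) / ((S.cell t α).card : ℝ) else 0)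

end FairData

namespace FairData

variable {A : Type*} [Fintype A] [DecidableEq A] {n : ℕ}

/-! Freezing the excluded groups turns the loss into a quadratic, half of `∑ j, C_j * (q j - y j) ^
2`, with `C_j ≥ 0`. Dropping the smallest error leaves the largest sum, so the loss dominates all
these quadratics and touches the one chosen at `p` at `p` itself (`sum_curvature_le`). Hence the
formula is a subgradient, and it is the gradient wherever one exists. A descent step multiplies
residual `j` by `1 - η_k C_j ∈ [0, 1]`, so each coordinate converges. The loss is monotone in the
absolute residuals, so its limit value bounds every iterate's loss from below. Each step lowers the
squared residuals by at least `2 η_k` times the loss, so divergence of `∑ η_k` forces loss zero at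
the limit, where the loss is `O(‖p - z‖²)`. -/

omit [DecidableEq A] in
/-- A function of the cutoff that factors through the pattern of samples above the cutoff and
a measurable choice of attribute combination is integrable. -/
theorem intervalIntegrable_pattern (S : FairData A n) {m : ℝ → A}
    (hm : ∀ α, MeasurableSet {t | m t = α}) (F : (Fin n → Prop) → A → ℝ) :
    IntervalIntegrable (fun t => F (fun i => t ≤ S.φ (S.y i)) (m t))
      MeasureTheory.volume 0 1 := by
  classical
  let _ : MeasurableSpace A := ⊤
  have hm' : Measurable m := measurable_to_countable' fun α => hm α
  have hr : Measurable fun t : ℝ => fun i : Fin n => t ≤ S.φ (S.y i) :=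
    measurable_pi_lambda _ fun i => measurableSet_setOfPred.1 measurableSet_Iic
  have hF : Measurable fun z : (Fin n → Prop) × A => F z.1 z.2 := measurable_of_countable _
  have hmeas : Measurable fun t => F (fun i => t ≤ S.φ (S.y i)) (m t) :=
    hF.comp (hr.prodMk hm')
  obtain ⟨B, hB⟩ := (Set.finite_range fun z : (Fin n → Prop) × A => ‖F z.1 z.2‖).bddAbove
  refine (intervalIntegrable_const (c := B)).mono_fun' hmeas.aestronglyMeasurable ?_
  exact Filter.Eventually.of_forall fun t => hB ⟨(fun i => t ≤ S.φ (S.y i), m t), rfl⟩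

/-- The integrand of `curvature`. -/
noncomputable def weight (S : FairData A n) (a : A) (t : ℝ) (j : Fin n) : ℝ :=
  ∑ α ∈ Finset.univ.erase a, (if j ∈ S.cell t α then 2 / ((S.cell t α).card : ℝ) else 0)

theorem curvature_eq (S : FairData A n) (m : ℝ → A) (j : Fin n) :
    S.curvature m j = ∫ t in (0 : ℝ)..1, S.weight (m t) t j := rfl

theorem weight_nonneg (S : FairData A n) (a : A) (t : ℝ) (j : Fin n) : 0 ≤ S.weight a t j :=
  Finset.sum_nonneg fun α _ => by split_ifs <;> positivity

theorem weight_le (S : FairData A n) (a : A) (t : ℝ) (j : Fin n) :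
    S.weight a t j ≤ 2 * Fintype.card A := by
  have h : ∀ α, (if j ∈ S.cell t α then 2 / ((S.cell t α).card : ℝ) else 0) ≤ 2 := by
    intro α
    split_ifs with hj
    · have : (1 : ℝ) ≤ (S.cell t α).card := by exact_mod_cast Finset.card_pos.2 ⟨j, hj⟩
      exact div_le_self (by norm_num) this
    · norm_num
  calc S.weight a t j
      ≤ ∑ α, (if j ∈ S.cell t α then 2 / ((S.cell t α).card : ℝ) else 0) :=
        Finset.sum_le_sum_of_subset_of_nonneg (Finset.erase_subset _ _)
          fun α _ _ => by split_ifs <;> positivity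
    _ ≤ ∑ _α : A, (2 : ℝ) := Finset.sum_le_sum fun α _ => h α
    _ = 2 * Fintype.card A := by simp [mul_comm]

theorem intervalIntegrable_weight (S : FairData A n) {m : ℝ → A}
    (hm : ∀ α, MeasurableSet {t | m t = α}) (j : Fin n) :
    IntervalIntegrable (fun t => S.weight (m t) t j) MeasureTheory.volume 0 1 := by
  classical
  let c : (Fin n → Prop) → A → Finset (Fin n) := fun r α =>
    Finset.univ.filter fun i => S.group i = α ∧ r i
  have hc : ∀ t α, S.cell t α = c (fun i => t ≤ S.φ (S.y i)) α := by
    intro t α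
    ext i
    simp [cell, c]
  have := S.intervalIntegrable_pattern hm fun r a =>
    ∑ α ∈ Finset.univ.erase a, (if j ∈ c r α then 2 / ((c r α).card : ℝ) else 0)
  simpa only [weight, hc] using this

theorem sum_erase_cellError (S : FairData A n) (p : EuclideanSpace ℝ (Fin n)) (a : A) (t : ℝ) :
    ∑ α ∈ Finset.univ.erase a, S.cellError p t α
      = (∑ j, S.weight a t j * (p j - S.y j) ^ 2) / 2 := by
  simp only [weight, Finset.sum_mul]
  rw [Finset.sum_comm, Finset.sum_div]
  refine Finset.sum_congr rfl fun α _ => ?_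
  simp only [cellError, ite_mul, zero_mul]
  rw [← Finset.sum_filter, Finset.sum_div, Finset.sum_div]
  refine Finset.sum_congr (by ext; simp) fun j _ => by ring

theorem lossGrad_apply (S : FairData A n) (αmin : EuclideanSpace ℝ (Fin n) → ℝ → A)
    (p : EuclideanSpace ℝ (Fin n)) (j : Fin n) :
    S.lossGrad αmin p j = S.curvature (αmin p) j * (p j - S.y j) := by
  rw [curvature_eq, ← intervalIntegral.integral_mul_const]
  refine intervalIntegral.integral_congr fun t _ => ?_
  simp only [weight, Finset.sum_mul]
  refine Finset.sum_congr rfl fun α _ => ?_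
  split_ifs <;> ring

theorem curvature_nonneg (S : FairData A n) (m : ℝ → A) (j : Fin n) : 0 ≤ S.curvature m j :=
  intervalIntegral.integral_nonneg zero_le_one fun t _ => S.weight_nonneg (m t) t j

theorem curvature_le (S : FairData A n) (m : ℝ → A) (j : Fin n) :
    S.curvature m j ≤ 2 * Fintype.card A := by
  have h := intervalIntegral.norm_integral_le_of_norm_le_const (a := (0 : ℝ)) (b := 1)
    (f := fun t => S.weight (m t) t j) (C := 2 * Fintype.card A) fun t _ => by
      rw [Real.norm_of_nonneg (S.weight_nonneg _ _ _)]
      exact S.weight_le _ _ _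
  simpa [curvature_eq] using (le_abs_self _).trans h

theorem integral_sum_weight_mul (S : FairData A n) {m : ℝ → A}
    (hm : ∀ α, MeasurableSet {t | m t = α}) (c : Fin n → ℝ) :
    ∫ t in (0 : ℝ)..1, ∑ j, S.weight (m t) t j * c j = ∑ j, S.curvature m j * c j := by
  rw [intervalIntegral.integral_finsetSum
    fun j _ => (S.intervalIntegrable_weight hm j).mul_const (c j)]
  exact Finset.sum_congr rfl fun j _ => by rw [intervalIntegral.integral_mul_const, curvature_eq]

namespace IsArgmin

variable {S : FairData A n} {αmin : EuclideanSpace ℝ (Fin n) → ℝ → A}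

theorem two_mul_IDLoss (hα : S.IsArgmin αmin) (p : EuclideanSpace ℝ (Fin n)) :
    2 * S.IDLoss αmin p = ∑ j, S.curvature (αmin p) j * (p j - S.y j) ^ 2 := by
  rw [← S.integral_sum_weight_mul (hα.measurable p) fun j => (p j - S.y j) ^ 2]
  simp only [IDLoss, sum_erase_cellError, intervalIntegral.integral_div]
  ring

omit [Fintype A] in
theorem cellError_le (hα : S.IsArgmin αmin) (p q : EuclideanSpace ℝ (Fin n)) {t : ℝ}
    (ht : t ∈ Set.Icc (0 : ℝ) 1) :
    S.cellError q t (αmin q t) ≤ S.cellError q t (αmin p t) := by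
  by_cases h : (S.cell t (αmin p t)).Nonempty
  · exact hα.le q t ht _ h
  -- An empty chosen cell means that no group is represented at `t`, so both errors are `0`.
  · have h' : ¬ (S.cell t (αmin q t)).Nonempty := fun hq => h (hα.nonempty p t ht ⟨_, hq⟩)
    rw [Finset.not_nonempty_iff_eq_empty] at h h'
    simp [cellError, h, h']

/-- The loss at `q` dominates the quadratic that excludes the combinations chosen at `p`. -/
theorem sum_curvature_le (hα : S.IsArgmin αmin) (p q : EuclideanSpace ℝ (Fin n)) :
    ∑ j, S.curvature (αmin p) j * (q j - S.y j) ^ 2 ≤ 2 * S.IDLoss αmin q := by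
  have hint : ∀ p, IntervalIntegrable
      (fun t => ∑ j, S.weight (αmin p t) t j * (q j - S.y j) ^ 2) MeasureTheory.volume 0 1 := by
    intro p
    have := IntervalIntegrable.sum Finset.univ fun j _ =>
      (S.intervalIntegrable_weight (hα.measurable p) j).mul_const ((q j - S.y j) ^ 2)
    simpa only [Finset.sum_fn] using this
  rw [hα.two_mul_IDLoss, ← S.integral_sum_weight_mul (hα.measurable p) fun j => (q j - S.y j) ^ 2,
    ← S.integral_sum_weight_mul (hα.measurable q) fun j => (q j - S.y j) ^ 2]
  refine intervalIntegral.integral_mono_on zero_le_one (hint p) (hint q) fun t ht => ?_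
  have hp := S.sum_erase_cellError q (αmin p t) t
  have hq := S.sum_erase_cellError q (αmin q t) t
  -- Both erased sums are the same full sum minus one term; only the removed errors need comparing.
  rw [Finset.sum_erase_eq_sub (Finset.mem_univ _)] at hp hq
  linarith [hα.cellError_le p q ht]

theorem IDLoss_nonneg (hα : S.IsArgmin αmin) (p : EuclideanSpace ℝ (Fin n)) :
    0 ≤ S.IDLoss αmin p := by
  have h : 0 ≤ 2 * S.IDLoss αmin p := by
    rw [hα.two_mul_IDLoss]
    exact Finset.sum_nonneg fun j _ => mul_nonneg (S.curvature_nonneg _ _) (sq_nonneg _)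
  linarith

/-- Compare `p` and `q` through the quadratic frozen at `p`, whose coefficients are nonnegative. -/
theorem IDLoss_le_of_abs_le (hα : S.IsArgmin αmin) {p q : EuclideanSpace ℝ (Fin n)}
    (h : ∀ j, |p j - S.y j| ≤ |q j - S.y j|) : S.IDLoss αmin p ≤ S.IDLoss αmin q := by
  have h1 := hα.sum_curvature_le p q
  have h2 : 2 * S.IDLoss αmin p ≤ ∑ j, S.curvature (αmin p) j * (q j - S.y j) ^ 2 := by
    rw [hα.two_mul_IDLoss]
    exact Finset.sum_le_sum fun j _ =>
      mul_le_mul_of_nonneg_left (sq_le_sq.2 (h j)) (S.curvature_nonneg _ _)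
  linarith

/-- `lossGrad` is a subgradient of the loss. -/
theorem IDLoss_add_inner_le (hα : S.IsArgmin αmin) (p q : EuclideanSpace ℝ (Fin n)) :
    S.IDLoss αmin p + inner ℝ (S.lossGrad αmin p) (q - p) ≤ S.IDLoss αmin q := by
  have h1 := hα.sum_curvature_le p q
  have h2 : 2 * S.IDLoss αmin p + 2 * inner ℝ (S.lossGrad αmin p) (q - p)
      ≤ ∑ j, S.curvature (αmin p) j * (q j - S.y j) ^ 2 := by
    rw [hα.two_mul_IDLoss, PiLp.inner_apply, Finset.mul_sum, ← Finset.sum_add_distrib]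
    refine Finset.sum_le_sum fun j _ => ?_
    simp only [lossGrad_apply, PiLp.sub_apply, RCLike.inner_apply, conj_trivial]
    -- The gap in each coordinate is exactly `C_j * (q j - p j) ^ 2`.
    nlinarith [mul_nonneg (S.curvature_nonneg (αmin p) j) (sq_nonneg (q j - p j))]
  linarith

theorem hasGradientAt_lossGrad (hα : S.IsArgmin αmin) {p : EuclideanSpace ℝ (Fin n)}
    (hd : DifferentiableAt ℝ (S.IDLoss αmin) p) :
    HasGradientAt (S.IDLoss αmin) (S.lossGrad αmin p) p := by
  set ℓ := InnerProductSpace.toDual ℝ (EuclideanSpace ℝ (Fin n)) (S.lossGrad αmin p) with hℓ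
  -- The subgradient inequality makes `p` a global minimum after subtracting the linear part.
  have hmin : IsLocalMin (fun q => S.IDLoss αmin q - ℓ q) p :=
    Filter.Eventually.of_forall fun q => by
      have h := hα.IDLoss_add_inner_le p q
      have : inner ℝ (S.lossGrad αmin p) (q - p) = ℓ q - ℓ p := by
        rw [← map_sub, hℓ, InnerProductSpace.toDual_apply_apply]
      simp only
      linarith
  have h0 := hmin.hasFDerivAt_eq_zero (hd.hasFDerivAt.sub ℓ.hasFDerivAt)
  have := hd.hasFDerivAt
  rw [sub_eq_zero.1 h0] at this
  exact this

/-- Zeros of the loss are stationary points. -/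
theorem hasGradientAt_zero (hα : S.IsArgmin αmin) {z : EuclideanSpace ℝ (Fin n)}
    (hz : S.IDLoss αmin z = 0) : HasGradientAt (S.IDLoss αmin) 0 z := by
  -- For every selection, either the curvature vanishes or `z j = y j`; so `y j` may be replaced by
  -- `z j` in the loss at any `p`.
  have hdich : ∀ p j, S.curvature (αmin p) j * (z j - S.y j) ^ 2 = 0 := by
    intro p j
    have hnn : ∀ j ∈ Finset.univ, 0 ≤ S.curvature (αmin p) j * (z j - S.y j) ^ 2 :=
      fun j _ => mul_nonneg (S.curvature_nonneg _ _) (sq_nonneg _)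
    have h := hα.sum_curvature_le p z
    rw [hz, mul_zero] at h
    exact (Finset.sum_eq_zero_iff_of_nonneg hnn).1 (le_antisymm h (Finset.sum_nonneg hnn)) j
      (Finset.mem_univ j)
  have hle : ∀ p, S.IDLoss αmin p ≤ Fintype.card A * ‖p - z‖ ^ 2 := by
    intro p
    have h : 2 * S.IDLoss αmin p ≤ 2 * Fintype.card A * ‖p - z‖ ^ 2 := by
      rw [hα.two_mul_IDLoss, EuclideanSpace.norm_sq_eq, Finset.mul_sum]
      refine Finset.sum_le_sum fun j _ => ?_
      rw [Real.norm_eq_abs, sq_abs, PiLp.sub_apply]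
      have : S.curvature (αmin p) j * (p j - S.y j) ^ 2
          = S.curvature (αmin p) j * (p j - z j) ^ 2 := by
        rcases mul_eq_zero.1 (hdich p j) with h | h
        · simp [h]
        · rw [← sub_eq_zero.1 (pow_eq_zero_iff two_ne_zero |>.1 h)]
      rw [this]
      exact mul_le_mul_of_nonneg_right (S.curvature_le _ _) (sq_nonneg _)
    linarith
  have hO : S.IDLoss αmin =O[𝓝 z] fun p => ‖p - z‖ ^ 2 :=
    Asymptotics.IsBigO.of_bound (Fintype.card A) <| Filter.Eventually.of_forall fun p => by
      rw [Real.norm_of_nonneg (hα.IDLoss_nonneg p), Real.norm_of_nonneg (by positivity)]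
      exact hle p
  rw [hasGradientAt_iff_hasFDerivAt, map_zero]
  exact hO.hasFDerivAt one_lt_two

theorem sum_sq_residual_step (hα : S.IsArgmin αmin) {p : EuclideanSpace ℝ (Fin n)} {s : ℝ}
    (hs : 0 < s) (hC : ∀ j, s * S.curvature (αmin p) j ≤ 1) :
    ∑ j, ((p - s • S.lossGrad αmin p) j - S.y j) ^ 2
      ≤ ∑ j, (p j - S.y j) ^ 2 - s * (2 * S.IDLoss αmin p) := by
  rw [hα.two_mul_IDLoss, Finset.mul_sum, ← Finset.sum_sub_distrib]
  refine Finset.sum_le_sum fun j _ => ?_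
  simp only [PiLp.sub_apply, PiLp.smul_apply, lossGrad_apply, smul_eq_mul]
  have h0 := mul_nonneg hs.le (S.curvature_nonneg (αmin p) j)
  -- With `h = s * C_j`: `(1 - h)² = 1 - h - h(1 - h) ≤ 1 - h`.
  nlinarith [mul_nonneg (mul_nonneg h0 (sub_nonneg.2 (hC j))) (sq_nonneg (p j - S.y j))]

end IsArgmin

/-- A real sequence whose successive ratios lie in `[0, 1]` converges, and its limit is no larger
than any of its terms in absolute value. -/
theorem exists_tendsto_of_contracting {u a : ℕ → ℝ} (h0 : ∀ k, 0 ≤ a k) (h1 : ∀ k, a k ≤ 1)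
    (hu : ∀ k, u (k + 1) = a k * u k) :
    ∃ l, Tendsto u atTop (𝓝 l) ∧ ∀ k, |l| ≤ |u k| := by
  have hprod : ∀ k, u k = (∏ i ∈ Finset.range k, a i) * u 0 := by
    intro k
    induction k with
    | zero => simp
    | succ k ih => rw [hu, Finset.prod_range_succ, ih]; ring
  have hanti : Antitone fun k => ∏ i ∈ Finset.range k, a i :=
    antitone_nat_of_succ_le fun k => by
      rw [Finset.prod_range_succ]
      exact mul_le_of_le_one_right (Finset.prod_nonneg fun i _ => h0 i) (h1 k)
  have hlim := tendsto_atTop_ciInf hanti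
    ⟨0, by rintro _ ⟨k, rfl⟩; exact Finset.prod_nonneg fun i _ => h0 i⟩
  have hlim' := (hlim.mul_const (u 0)).congr fun k => (hprod k).symm
  have habs : Antitone fun k => |u k| :=
    antitone_nat_of_succ_le fun k => by
      rw [hu, abs_mul, abs_of_nonneg (h0 k)]
      exact mul_le_of_le_one_left (abs_nonneg _) (h1 k)
  exact ⟨_, hlim', fun k => habs.le_of_tendsto hlim'.abs k⟩

end FairData

theorem mainTheorem1 {A : Type*} [Fintype A] [DecidableEq A] {n : ℕ} (S : FairData A n)
    (αmin : EuclideanSpace ℝ (Fin n) → ℝ → A) (hα : S.IsArgmin αmin) :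
    (∀ p, DifferentiableAt ℝ (S.IDLoss αmin) p →
      HasGradientAt (S.IDLoss αmin) (S.lossGrad αmin p) p) ∧
    ∀ (η : ℕ → ℝ) (x : ℕ → EuclideanSpace ℝ (Fin n)),
      (∀ k, 0 < η k) → ¬ Summable η →
      (∀ k j, η k * S.curvature (αmin (x k)) j ≤ 1) →
      (∀ k, x (k + 1) = x k - η k • S.lossGrad αmin (x k)) →
      ∃ z : EuclideanSpace ℝ (Fin n),
        Tendsto x atTop (𝓝 z) ∧ HasGradientAt (S.IDLoss αmin) 0 z := by
  refine ⟨fun p hd => hα.hasGradientAt_lossGrad hd, fun η x hη hsum hC hx => ?_⟩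
  have hres : ∀ j, ∃ l, Tendsto (fun k => x k j - S.y j) atTop (𝓝 l) ∧
      ∀ k, |l| ≤ |x k j - S.y j| := fun j =>
    FairData.exists_tendsto_of_contracting
      (a := fun k => 1 - η k * S.curvature (αmin (x k)) j)
      (fun k => sub_nonneg.2 (hC k j))
      (fun k => sub_le_self _ (mul_nonneg (hη k).le (S.curvature_nonneg _ _)))
      (fun k => by
        rw [hx]
        simp only [PiLp.sub_apply, PiLp.smul_apply, FairData.lossGrad_apply, smul_eq_mul]
        ring)
  choose l hl hle using hres
  let z : EuclideanSpace ℝ (Fin n) := WithLp.toLp 2 fun j => l j + S.y j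
  have hz : ∀ j, z j - S.y j = l j := fun j => add_sub_cancel_right _ _
  have hxz : Tendsto x atTop (𝓝 z) := by
    have hpi : Tendsto (fun k => WithLp.ofLp (x k)) atTop (𝓝 fun j => l j + S.y j) :=
      tendsto_pi_nhds.2 fun j => by simpa using (hl j).add_const (S.y j)
    exact ((PiLp.continuous_toLp 2 fun _ : Fin n => ℝ).tendsto _).comp hpi
  refine ⟨z, hxz, hα.hasGradientAt_zero ?_⟩
  have hmono : ∀ k, S.IDLoss αmin z ≤ S.IDLoss αmin (x k) := fun k =>
    hα.IDLoss_le_of_abs_le fun j => by rw [hz]; exact hle j k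
  by_contra hne
  have hpos : 0 < S.IDLoss αmin z := lt_of_le_of_ne (hα.IDLoss_nonneg z) (Ne.symm hne)
  -- Telescoped decrease, each iterate's loss being replaced by the smaller loss at `z`; a positive
  -- value there would bound the partial sums of `η`.
  have hbound : ∀ N, (∑ k ∈ Finset.range N, η k) * (2 * S.IDLoss αmin z)
      + ∑ j, (x N j - S.y j) ^ 2 ≤ ∑ j, (x 0 j - S.y j) ^ 2 := by
    intro N
    induction N with
    | zero => simp
    | succ N ih =>
      have h := hα.sum_sq_residual_step (hη N) (hC N)
      rw [← hx] at h
      rw [Finset.sum_range_succ]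
      linarith [mul_le_mul_of_nonneg_left (hmono N) (hη N).le]
  refine hsum (summable_of_sum_range_le (c := (∑ j, (x 0 j - S.y j) ^ 2) / (2 * S.IDLoss αmin z))
    (fun k => (hη k).le) fun N => ?_)
  rw [le_div_iff₀ (by positivity)]
  have : 0 ≤ ∑ j, (x N j - S.y j) ^ 2 := Finset.sum_nonneg fun j _ => sq_nonneg _
  linarith [hbound N]
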